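/- Let $r,s\ge 0$ and $n,k,\lambda\ge 1$ be integers with $\max\{r,s\}\le n\le k$, and let $\rho=(\rho_1,\dots,\rho_k)$ be a $k$-tuple of integers with $1\le\rho_\ell\le\lambda n$ for all $\ell\in[k]=\{1,\dots,k\}$ and $\sum_{\ell\in[k]}\rho_\ell=\lambda n^2$. An $r\times s$ $\lambda$-matrix $M$ is an $r\times s$ array each of whose cells contains a multiset of exactly $\lambda$ elements (symbols) of $[k]$. Write $|M_\ell|$, $|M_\ell^i|$ and $|{}^jM_\ell|$ for the number of occurrences of the symbol $\ell$ in $M$, in row $i$ of $M$, and in column $j$ of $M$, respectively. An $r\times s$ $(\rho,\lambda)$-Latin rectangle is an $r\times s$ $\lambda$-matrix $M$ with $|M_\ell|\le\rho_\ell$, $|M^i_\ell|\le\lambda$ and $|{}^jM_\ell|\le\lambda$ for all $\ell\in[k]$, $i\in[r]$, $j\in[s]$. An $n\times n$ $(\rho,\lambda)$-Latin square is an $n\times n$ $\lambda$-matrix $N$ with $|N_\ell|=\rho_\ell$, $|N^i_\ell|\le\lambda$ and $|{}^jN_\ell|\le\lambda$ for all $\ell\in[k]$, $i,j\in[n]$.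 Such an array is simple if no symbol occurs more than once in any cell. The square $N$ extends the rectangle $M$ if the top left $r\times s$ corner of $N$ is $M$. Write $x\dot-y=\max\{0,x-y\}$, $\bar K=[k]\setminus K$, and, for a $(\rho,\lambda)$-Latin rectangle $M$, put $$p_\ell=(\rho_\ell-|M_\ell|+\lambda r)\dot-\lambda n,\qquad q_\ell=(\rho_\ell-|M_\ell|+\lambda s)\dot-\lambda n,$$ $$u_{i\ell}=\min\{n-s,\ \lambda-|M^i_\ell|\},\qquad v_{j\ell}=\min\{n-r,\ \lambda-|{}^jM_\ell|\}.$$ A simple $r\times s$ $(\rho,\lambda)$-Latin rectangle $M$ is simply admissible if $\lambda\le k$ and there are non-negative integers $a_\ell,b_\ell$ $(\ell\in[k])$ such that 1. $\sum_{\ell\in[k]}a_\ell=\lambda r(n-s)-\sum_{\ell\in[k]}p_\ell$ and $\sum_{\ell\in[k]}b_\ell=\lambda s(n-r)-\sum_{\ell\in[k]}q_\ell$; 2. $a_\ell\le\sum_{i\in[r]}u_{i\ell}-p_\ell$ and $b_\ell\le\sum_{j\in[s]}v_{j\ell}-q_\ell$ for all $\ell\in[k]$; 3. $\rho_\ell-|M_\ell|-p_\ell-q_\ell-(n-r)(n-s)\le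 a_\ell+b_\ell\le\rho_\ell-|M_\ell|-p_\ell-q_\ell$ for all $\ell\in[k]$; 4. $\lambda(n-s)\le\sum_{\ell\in[k]}u_{i\ell}$ for all $i\in[r]$, and $\lambda(n-r)\le\sum_{\ell\in[k]}v_{j\ell}$ for all $j\in[s]$; 5. for all $K\subseteq[k]$, $$\sum_{i\in[r]}\Big(\lambda(n-s)\dot-\sum_{\ell\in K}u_{i\ell}\Big)\le\sum_{\ell\in\bar K}(a_\ell+p_\ell)\quad\text{and}\quad\sum_{j\in[s]}\Big(\lambda(n-r)\dot-\sum_{\ell\in K}v_{j\ell}\Big)\le\sum_{\ell\in\bar K}(b_\ell+q_\ell).$$ Theorem. A simple $r\times s$ $(\rho,\lambda)$-Latin rectangle can be extended to a simple $n\times n$ $(\rho,\lambda)$-Latin square if and only if it is simply admissible. -/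

import Mathlib

namespace MultiLatin

/-- An `r × s` array whose cells contain multisets of symbols; the `k` symbols are the elements
of `Fin k`. -/
abbrev SymbolArray (r s k : ℕ) : Type := Fin r → Fin s → Multiset (Fin k)

variable {r s k : ℕ}

/-- The number of occurrences of the symbol `l` in row `i`. -/
def rowCount (M : SymbolArray r s k) (i : Fin r) (l : Fin k) : ℕ :=
  ∑ j : Fin s, (M i j).count l

/-- The number of occurrences of the symbol `l` in column `j`. -/
def colCount (M : SymbolArray r s k) (j : Fin s) (l : Fin k) : ℕ :=
  ∑ i : Fin r, (M i j).count l

/-- The total number of occurrences of the symbol `l`. -/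
def totalCount (M : SymbolArray r s k) (l : Fin k) : ℕ :=
  ∑ i : Fin r, ∑ j : Fin s, (M i j).count l

/-- Every cell contains exactly `lam` symbols, counted with multiplicity. -/
def IsLambdaMatrix (lam : ℕ) (M : SymbolArray r s k) : Prop :=
  ∀ i j, (M i j).card = lam

/-- An `r × s` `(ρ, lam)`-Latin rectangle. -/
structure IsLatinRectangle (ρ : Fin k → ℕ) (lam : ℕ) (M : SymbolArray r s k) : Prop where
  isLambdaMatrix : IsLambdaMatrix lam M
  total_le : ∀ l, totalCount M l ≤ ρ l
  row_le : ∀ i l, rowCount M i l ≤ lam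
  col_le : ∀ j l, colCount M j l ≤ lam

/-- An `n × n` `(ρ, lam)`-Latin square. -/
structure IsLatinSquare {n : ℕ} (ρ : Fin k → ℕ) (lam : ℕ) (N : SymbolArray n n k) : Prop where
  isLambdaMatrix : IsLambdaMatrix lam N
  total_eq : ∀ l, totalCount N l = ρ l
  row_le : ∀ i l, rowCount N i l ≤ lam
  col_le : ∀ j l, colCount N j l ≤ lam

/-- No symbol is repeated in any cell. -/
def IsSimple (M : SymbolArray r s k) : Prop :=
  ∀ i j l, (M i j).count l ≤ 1

/-- The square `N` has `M` as its top left `r × s` corner. -/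
def IsExtensionOf {n : ℕ} (hr : r ≤ n) (hs : s ≤ n)
    (N : SymbolArray n n k) (M : SymbolArray r s k) : Prop :=
  ∀ (i : Fin r) (j : Fin s), N (Fin.castLE hr i) (Fin.castLE hs j) = M i j

/-- Truncated subtraction of integers: `max {0, x - y}`. -/
def monus (x y : ℤ) : ℤ := max 0 (x - y)

/-- `(ρ_l - |M_l| + lam * t) ∸ lam * n`, used with `t = r` and `t = s`. -/
def forced (n : ℕ) (ρ : Fin k → ℕ) (lam : ℕ) (M : SymbolArray r s k) (t : ℕ) (l : Fin k) : ℤ :=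
  monus ((ρ l : ℤ) - totalCount M l + lam * t) (lam * n)

/-- `min {n - s, lam - |M_l^i|}`, for the row `i` and the symbol `l`. -/
def rowRoom (n lam : ℕ) (M : SymbolArray r s k) (i : Fin r) (l : Fin k) : ℤ :=
  min ((n : ℤ) - s) ((lam : ℤ) - rowCount M i l)

/-- `min {n - r, lam - |^jM_l|}`, for the column `j` and the symbol `l`. -/
def colRoom (n lam : ℕ) (M : SymbolArray r s k) (j : Fin s) (l : Fin k) : ℤ :=
  min ((n : ℤ) - r) ((lam : ℤ) - colCount M j l)

/-- The conditions that simple admissibility imposes on the sequence of pairs `(a l, b l)`.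
All arithmetic takes place in `ℤ`. -/
structure IsSimpleAdmissibleSeq (n : ℕ) (ρ : Fin k → ℕ) (lam : ℕ) (M : SymbolArray r s k)
    (a b : Fin k → ℕ) : Prop where
  sum_a : ∑ l, (a l : ℤ) = lam * r * ((n : ℤ) - s) - ∑ l, forced n ρ lam M r l
  sum_b : ∑ l, (b l : ℤ) = lam * s * ((n : ℤ) - r) - ∑ l, forced n ρ lam M s l
  a_le : ∀ l, (a l : ℤ) ≤ ∑ i, rowRoom n lam M i l - forced n ρ lam M r l
  b_le : ∀ l, (b l : ℤ) ≤ ∑ j, colRoom n lam M j l - forced n ρ lam M s l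
  add_le : ∀ l, (a l : ℤ) + b l ≤
    (ρ l : ℤ) - totalCount M l - forced n ρ lam M r l - forced n ρ lam M s l
  le_add : ∀ l,
    (ρ l : ℤ) - totalCount M l - forced n ρ lam M r l - forced n ρ lam M s l
      - ((n : ℤ) - r) * ((n : ℤ) - s) ≤ (a l : ℤ) + b l
  row_room : ∀ i, lam * ((n : ℤ) - s) ≤ ∑ l, rowRoom n lam M i l
  col_room : ∀ j, lam * ((n : ℤ) - r) ≤ ∑ l, colRoom n lam M j l
  row_set : ∀ K : Finset (Fin k),
    ∑ i, monus (lam * ((n : ℤ) - s)) (∑ l ∈ K, rowRoom n lam M i l) ≤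
      ∑ l ∈ Kᶜ, ((a l : ℤ) + forced n ρ lam M r l)
  col_set : ∀ K : Finset (Fin k),
    ∑ j, monus (lam * ((n : ℤ) - r)) (∑ l ∈ K, colRoom n lam M j l) ≤
      ∑ l ∈ Kᶜ, ((b l : ℤ) + forced n ρ lam M s l)

/-- Simple admissibility, relative to the order `n` of the square to be completed. -/
def IsSimplyAdmissible (n : ℕ) (ρ : Fin k → ℕ) (lam : ℕ) (M : SymbolArray r s k) : Prop :=
  lam ≤ k ∧ ∃ a b : Fin k → ℕ, IsSimpleAdmissibleSeq n ρ lam M a b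

end MultiLatin

/-! Merge the `n - r` new rows into one row and the `n - s` new columns into one column. What an
extension of `M` leaves behind is an outline: the counts `x`, `y`, `c` of each symbol in the three
new blocks. An extension exists exactly when an outline does, and admissibility says exactly that an
outline exists.

Outlines and admissibility: the `n - r` new rows hold at most `lam * (n - r)` copies of `l`, so at
least `forced n ρ lam M r l` copies must go to the right of `M`, and `a l` is the excess of `∑ i, x
i l` over this; `b` plays the same role below `M`. Given `a` and `b`, the matrices `x` and `y` are
integral flows with capacities `rowRoom` and `colRoom`. Condition 5 is the cut condition for them,
and the corner takes the remaining copies.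

Outlines and squares: merging a square gives an outline by counting. Conversely, the merged column
and the merged row are split by `exists_decomposition_le`: dividing a matrix by `m` gives a
fractional matrix that can be rounded with its line sums kept, so equal parts can be peeled off one
at a time. Capacity 1 in the parts keeps the square simple. -/

namespace MultiLatin

/-! ### Integral transportation from Hall's theorem -/

open Finset in
/-- The capacitated transportation theorem: supplies `R`, demands `C`, capacities `u`. -/
theorem exists_transport_le {A B : Type*} [Fintype A] [Fintype B] (u : A → B → ℕ) (R : A → ℕ)
    (C : B → ℕ)
    (h : ∀ (I : Finset A) (K K' : Finset B), (∀ b, b ∈ K ∨ b ∈ K') →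
      ∑ a ∈ I, R a ≤ ∑ b ∈ K', C b + ∑ a ∈ I, ∑ b ∈ K, u a b) :
    ∃ x : A → B → ℕ, (∀ a b, x a b ≤ u a b) ∧ (∀ a, ∑ b, x a b = R a) ∧
      ∀ b, ∑ a, x a b ≤ C b := by
  classical
  -- Hall's theorem is applied to a graph in which each unit edge has a left and a right copy. A
  -- unit of supply takes the right copy of an edge at its row. A left copy takes its own right copy
  -- if the edge is idle, and otherwise a unit of demand at its column.
  let E := Σ p : A × B, Fin (u p.1 p.2)
  let t : (Σ a, Fin (R a)) ⊕ E → Finset (E ⊕ (Σ b, Fin (C b))) := fun v =>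
    match v with
    | .inl v => univ.filter fun w => ∃ e : E, e.1.1 = v.1 ∧ w = .inl e
    | .inr e => univ.filter fun w => w = .inl e ∨ ∃ y : Σ b, Fin (C b), y.1 = e.1.2 ∧ w = .inr y
  have hall : ∀ S : Finset ((Σ a, Fin (R a)) ⊕ E), #S ≤ #(S.biUnion t) := by
    intro S
    -- The neighbours of `S` include the right copies of `E'`, all demand units at `B'`, and the
    -- edges `E''` from `I` to the complement of `B'`. The last are disjoint from `E'`, so the cut
    -- `I`, `B'ᶜ`, `B'` gives Hall's inequality.
    let I : Finset A := univ.filter fun a => ∃ v : Σ a, Fin (R a), v.1 = a ∧ .inl v ∈ S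
    have hI : ∀ a, a ∈ I ↔ ∃ v : Σ a, Fin (R a), v.1 = a ∧ .inl v ∈ S := fun a => by simp [I]
    let E' : Finset E := univ.filter fun e => .inr e ∈ S
    let B' : Finset B := E'.image fun e => e.1.2
    let E'' : Finset E := (I ×ˢ B'ᶜ).sigma fun p => (univ : Finset (Fin (u p.1 p.2)))
    have h1 : #S ≤ ∑ a ∈ I, R a + #E' := by
      have : S ⊆ (I.sigma fun a => (univ : Finset (Fin (R a)))).disjSum E' := by
        rintro (v | e) hv
        · simp only [inl_mem_disjSum, mem_sigma, mem_univ, and_true]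
          exact (hI _).2 ⟨v, rfl, hv⟩
        · simpa [E'] using hv
      refine (card_le_card this).trans (le_of_eq ?_)
      rw [card_disjSum, card_sigma]
      simp
    have h2 : #E' + #E'' + ∑ b ∈ B', C b ≤ #(S.biUnion t) := by
      have hd : Disjoint E' E'' := by
        rw [disjoint_left]
        intro e he he'
        exact mem_compl.1 (mem_product.1 (mem_sigma.1 he').1).2 (mem_image_of_mem _ he)
      have hs : (E' ∪ E'').disjSum (B'.sigma fun b => (univ : Finset (Fin (C b)))) ⊆
          S.biUnion t := by
        rintro (e | y) hy
        · rw [inl_mem_disjSum, mem_union] at hy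
          rcases hy with hy | hy
          · exact mem_biUnion.2 ⟨.inr e, (mem_filter.1 hy).2, by simp [t]⟩
          · obtain ⟨v, hv, hvS⟩ := (hI _).1 (mem_product.1 (mem_sigma.1 hy).1).1
            exact mem_biUnion.2 ⟨.inl v, hvS, mem_filter.2 ⟨mem_univ _, e, hv.symm, rfl⟩⟩
        · simp only [inr_mem_disjSum, mem_sigma, mem_univ, and_true] at hy
          obtain ⟨e, he, hey⟩ := mem_image.1 hy
          exact mem_biUnion.2 ⟨.inr e, (mem_filter.1 he).2,
            mem_filter.2 ⟨mem_univ _, .inr ⟨y, hey.symm, rfl⟩⟩⟩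
      have := card_le_card hs
      rw [card_disjSum, card_union_of_disjoint hd, card_sigma B'] at this
      simpa only [card_univ, Fintype.card_fin] using this
    have h3 : #E'' = ∑ a ∈ I, ∑ b ∈ B'ᶜ, u a b := by
      rw [card_sigma, sum_product]
      simp
    have := h I B'ᶜ B' (fun b => by simpa using (em (b ∈ B')).symm)
    omega
  obtain ⟨f, hf, hft⟩ := (Finset.all_card_le_biUnion_card_iff_exists_injective t).1 hall
  -- `T` is the set of edges that carry flow. Their right copies are taken by supply, so by
  -- injectivity their left copies are matched with units of demand.
  let T : Finset E := univ.filter fun e => ∃ v : Σ a, Fin (R a), f (.inl v) = .inl e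
  have hfl : ∀ v : Σ a, Fin (R a), ∃ e : E, e.1.1 = v.1 ∧ f (.inl v) = .inl e := fun v =>
    (mem_filter.1 (hft (.inl v))).2
  have hfr : ∀ e ∈ T, ∃ y : Σ b, Fin (C b), y.1 = e.1.2 ∧ f (.inr e) = .inr y := by
    intro e he
    rcases (mem_filter.1 (hft (.inr e))).2 with h | h
    · obtain ⟨v, hv⟩ := (mem_filter.1 he).2
      exact absurd (hf (hv.trans h.symm)) (by simp)
    · exact h
  choose! g hg1 hg2 using hfl
  refine ⟨fun a b => #(T.filter fun e => e.1 = (a, b)), fun a b => ?_, fun a => ?_, fun b => ?_⟩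
  · have : T.filter (fun e => e.1 = (a, b)) ⊆
        (univ : Finset (Fin (u a b))).image fun t => (⟨(a, b), t⟩ : E) := by
      rintro ⟨p, t⟩ he
      obtain rfl : p = (a, b) := (mem_filter.1 he).2
      exact mem_image_of_mem _ (mem_univ t)
    simpa using (card_le_card this).trans card_image_le
  · have h1 : #(T.filter fun e => e.1.1 = a) = ∑ b, #(T.filter fun e => e.1 = (a, b)) := by
      rw [card_eq_sum_card_fiberwise (f := fun e : E => e.1.2) (t := univ) (by simp)]
      refine sum_congr rfl fun b _ => ?_
      rw [filter_filter]
      congr 1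
      ext e
      simp [Prod.ext_iff]
    rw [← h1]
    have h2 : #(univ : Finset (Fin (R a))) = #(T.filter fun e => e.1.1 = a) := by
      refine card_bij (fun t _ => g ⟨a, t⟩) (fun t _ => ?_) (fun t _ t' _ h => ?_) (fun e he => ?_)
      · exact mem_filter.2 ⟨mem_filter.2 ⟨mem_univ _, _, hg2 _⟩, hg1 _⟩
      · have := hf ((hg2 ⟨a, t⟩).trans ((congrArg Sum.inl h).trans (hg2 ⟨a, t'⟩).symm))
        simpa using this
      · obtain ⟨heT, rfl⟩ := mem_filter.1 he
        have hv : ∃ v : Σ a, Fin (R a), f (.inl v) = .inl e := (mem_filter.1 heT).2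
        obtain ⟨⟨a', t⟩, hv⟩ := hv
        have h3 : g ⟨a', t⟩ = e := Sum.inl_injective ((hg2 _).symm.trans hv)
        have h4 : e.1.1 = a' := by rw [← h3]; exact hg1 _
        subst h4
        exact ⟨t, mem_univ _, h3⟩
    simpa using h2.symm
  · have h1 : #(T.filter fun e => e.1.2 = b) = ∑ a, #(T.filter fun e => e.1 = (a, b)) := by
      rw [card_eq_sum_card_fiberwise (f := fun e : E => e.1.1) (t := univ) (by simp)]
      refine sum_congr rfl fun a _ => ?_
      rw [filter_filter]
      congr 1
      ext e
      simp [Prod.ext_iff, and_comm]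
    rw [← h1]
    have h2 : #(T.filter fun e => e.1.2 = b) ≤
        #((({b} : Finset B).sigma fun b => (univ : Finset (Fin (C b)))).image
          (Sum.inr : _ → E ⊕ (Σ b, Fin (C b)))) := by
      refine card_le_card_of_injOn (fun e => f (.inr e)) (fun e he => ?_)
        (fun e _ e' _ h => Sum.inr_injective (hf h))
      have he := mem_filter.1 (mem_coe.1 he)
      obtain ⟨y, hy, hfy⟩ := hfr e he.1
      refine mem_coe.2 (mem_image.2 ⟨y, mem_sigma.2 ⟨?_, mem_univ _⟩, hfy.symm⟩)
      rw [hy, he.2, mem_singleton]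
    have h3 := h2.trans card_image_le
    rw [card_sigma] at h3
    simpa using h3

/-- The transportation theorem with equal total supply and demand. -/
theorem exists_transport {A B : Type*} [Fintype A] [Fintype B] (u : A → B → ℕ) (R : A → ℕ)
    (C : B → ℕ) (hRC : ∑ a, R a = ∑ b, C b)
    (h : ∀ (I : Finset A) (K K' : Finset B), (∀ b, b ∈ K ∨ b ∈ K') →
      ∑ a ∈ I, R a ≤ ∑ b ∈ K', C b + ∑ a ∈ I, ∑ b ∈ K, u a b) :
    ∃ x : A → B → ℕ, (∀ a b, x a b ≤ u a b) ∧ (∀ a, ∑ b, x a b = R a) ∧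
      ∀ b, ∑ a, x a b = C b := by
  obtain ⟨x, hx, hR, hC⟩ := exists_transport_le u R C h
  refine ⟨x, hx, hR, fun b => ?_⟩
  have : ∑ b, ∑ a, x a b = ∑ b, C b := by
    rw [Finset.sum_comm, ← hRC]
    exact Finset.sum_congr rfl fun a _ => hR a
  exact (Finset.sum_eq_sum_iff_of_le fun b _ => hC b).1 this b (Finset.mem_univ b)

/-! ### Rounding and decomposition of matrices -/

/-- If `x / m` is a matrix with entries between `L` and `U` and with integral line sums, then
there is an integral matrix with the same bounds and line sums. -/
theorem exists_rounding {A B : Type*} [Fintype A] [Fintype B] (m : ℕ) (hm : 0 < m)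
    (x L U : A → B → ℕ) (R : A → ℕ) (C : B → ℕ)
    (hL : ∀ a b, m * L a b ≤ x a b) (hU : ∀ a b, x a b ≤ m * U a b)
    (hR : ∀ a, ∑ b, x a b = m * R a) (hC : ∀ b, ∑ a, x a b = m * C b) :
    ∃ y : A → B → ℕ, (∀ a b, L a b ≤ y a b ∧ y a b ≤ U a b) ∧ (∀ a, ∑ b, y a b = R a) ∧
      ∀ b, ∑ a, y a b = C b := by
  have hLU : ∀ a b, L a b ≤ U a b := fun a b =>
    Nat.le_of_mul_le_mul_left ((hL a b).trans (hU a b)) hm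
  have hLR : ∀ a, ∑ b, L a b ≤ R a := fun a => by
    refine Nat.le_of_mul_le_mul_left ?_ hm
    rw [← hR, Finset.mul_sum]
    exact Finset.sum_le_sum fun b _ => hL a b
  have hLC : ∀ b, ∑ a, L a b ≤ C b := fun b => by
    refine Nat.le_of_mul_le_mul_left ?_ hm
    rw [← hC, Finset.mul_sum]
    exact Finset.sum_le_sum fun a _ => hL a b
  have eR : ∀ a, m * (R a - ∑ b, L a b) = ∑ b, (x a b - m * L a b) := fun a => by
    rw [Finset.sum_tsub_distrib _ fun b _ => hL a b, hR, Nat.mul_sub, Finset.mul_sum]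
  have eC : ∀ b, m * (C b - ∑ a, L a b) = ∑ a, (x a b - m * L a b) := fun b => by
    rw [Finset.sum_tsub_distrib _ fun a _ => hL a b, hC, Nat.mul_sub, Finset.mul_sum]
  -- Subtracting `L` turns the lower bounds into 0. The cut condition, multiplied by `m`, holds
  -- because the fractional flow `x - m * L` satisfies it.
  have key := exists_transport (fun a b => U a b - L a b) (fun a => R a - ∑ b, L a b)
    (fun b => C b - ∑ a, L a b) ?_ ?_
  · obtain ⟨z, hz, hzR, hzC⟩ := key
    refine ⟨fun a b => L a b + z a b, fun a b => ⟨Nat.le_add_right _ _, ?_⟩, fun a => ?_,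
      fun b => ?_⟩
    · have := hz a b
      have := hLU a b
      dsimp only
      omega
    · rw [Finset.sum_add_distrib, hzR]
      exact Nat.add_sub_cancel' (hLR a)
    · rw [Finset.sum_add_distrib, hzC]
      exact Nat.add_sub_cancel' (hLC b)
  · refine Nat.eq_of_mul_eq_mul_left hm ?_
    rw [Finset.mul_sum, Finset.mul_sum, Finset.sum_congr rfl fun a _ => eR a,
      Finset.sum_congr rfl fun b _ => eC b, Finset.sum_comm]
  · classical
    intro I K K' hKK
    refine Nat.le_of_mul_le_mul_left ?_ hm
    rw [mul_add, Finset.mul_sum, Finset.mul_sum, Finset.mul_sum,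
      Finset.sum_congr rfl fun a _ => eR a, Finset.sum_congr rfl fun b _ => eC b]
    calc ∑ a ∈ I, ∑ b, (x a b - m * L a b)
        ≤ ∑ a ∈ I, (∑ b ∈ K', (x a b - m * L a b) + ∑ b ∈ K, (x a b - m * L a b)) := by
          refine Finset.sum_le_sum fun a _ => ?_
          rw [← Finset.sum_union_inter]
          refine le_add_right (Finset.sum_le_sum_of_subset fun b _ => ?_)
          exact Finset.mem_union.2 (hKK b).symm
      _ ≤ _ := by
          rw [Finset.sum_add_distrib, Finset.sum_comm]
          refine add_le_add (Finset.sum_le_sum fun b _ => ?_) (Finset.sum_le_sum fun a _ => ?_)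
          · exact Finset.sum_le_sum_of_subset (Finset.subset_univ I)
          · rw [Finset.mul_sum]
            refine Finset.sum_le_sum fun b _ => ?_
            rw [Nat.mul_sub]
            exact Nat.sub_le_sub_right (hU a b) _

/-- A matrix whose line sums are divisible by `m` is a sum of `m` matrices with equal line sums
and with entries bounded by `e`, provided that its own entries are bounded by `m * e`. -/
theorem exists_decomposition {A B : Type*} [Fintype A] [Fintype B] (m : ℕ)
    (x e : A → B → ℕ) (R : A → ℕ) (C : B → ℕ) (he : ∀ a b, x a b ≤ m * e a b)
    (hR : ∀ a, ∑ b, x a b = m * R a) (hC : ∀ b, ∑ a, x a b = m * C b) :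
    ∃ f : Fin m → A → B → ℕ, (∀ a b, ∑ c, f c a b = x a b) ∧ (∀ c a b, f c a b ≤ e a b) ∧
      (∀ c a, ∑ b, f c a b = R a) ∧ ∀ c b, ∑ a, f c a b = C b := by
  induction m generalizing x with
  | zero =>
    refine ⟨fun c => c.elim0, fun a b => ?_, fun c => c.elim0, fun c => c.elim0,
      fun c => c.elim0⟩
    have := he a b
    simp at this
    simp [this]
  | succ m ih =>
    -- The lower bound `x - m * e` is what makes the remainder `x - y` at most `m * e`, as the
    -- induction requires. It lies below `x / (m + 1)` because `x ≤ (m + 1) * e`.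
    obtain ⟨y, hy, hyR, hyC⟩ := exists_rounding (m + 1) m.succ_pos x
      (fun a b => x a b - m * e a b) (fun a b => min (x a b) (e a b)) R C
      (fun a b => by
        have h1 := he a b
        rw [Nat.mul_sub, Nat.sub_le_iff_le_add]
        nlinarith)
      (fun a b => by
        rcases min_cases (x a b) (e a b) with h | h
        · rw [h.1]; exact Nat.le_mul_of_pos_left _ m.succ_pos
        · rw [h.1]; exact he a b)
      hR hC
    have hyx : ∀ a b, y a b ≤ x a b := fun a b => (hy a b).2.trans (min_le_left _ _)
    obtain ⟨f, hf, hfe, hfR, hfC⟩ := ih (fun a b => x a b - y a b)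
      (fun a b => by have := (hy a b).1; omega)
      (fun a => by
        rw [Finset.sum_tsub_distrib _ fun b _ => hyx a b, hR, hyR, add_mul, one_mul,
          Nat.add_sub_cancel])
      (fun b => by
        rw [Finset.sum_tsub_distrib _ fun a _ => hyx a b, hC, hyC, add_mul, one_mul,
          Nat.add_sub_cancel])
    refine ⟨Fin.cons y f, fun a b => ?_, fun c => ?_, fun c => ?_, fun c => ?_⟩
    · rw [Fin.sum_univ_succ]
      simp only [Fin.cons_zero, Fin.cons_succ, hf]
      exact Nat.add_sub_cancel' (hyx a b)
    · refine Fin.cases (fun a b => ?_) (fun c => ?_) c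
      · exact (hy a b).2.trans (min_le_right _ _)
      · exact hfe c
    · refine Fin.cases hyR (fun c => ?_) c
      exact hfR c
    · refine Fin.cases hyC (fun c => ?_) c
      exact hfC c

/-- The variant of `exists_decomposition` with inequalities for the column sums. -/
theorem exists_decomposition_le {A B : Type*} [Fintype A] [Fintype B] (m : ℕ)
    (x e : A → B → ℕ) (R : A → ℕ) (C : B → ℕ) (he : ∀ a b, x a b ≤ m * e a b)
    (hR : ∀ a, ∑ b, x a b = m * R a) (hC : ∀ b, ∑ a, x a b ≤ m * C b) :
    ∃ f : Fin m → A → B → ℕ, (∀ a b, ∑ c, f c a b = x a b) ∧ (∀ c a b, f c a b ≤ e a b) ∧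
      (∀ c a, ∑ b, f c a b = R a) ∧ ∀ c b, ∑ a, f c a b ≤ C b := by
  -- The extra row `none` holds the slack of each column, which turns the column inequalities into
  -- equalities.
  have key := exists_decomposition (A := Option A) m
    (fun o b => o.elim (m * C b - ∑ a, x a b) fun a => x a b)
    (fun o b => o.elim (C b) fun a => e a b)
    (fun o => o.elim (∑ b, C b - ∑ a, R a) R) C ?_ ?_ ?_
  · obtain ⟨f, hf, hfe, hfR, hfC⟩ := key
    refine ⟨fun c a b => f c (some a) b, fun a b => hf (some a) b, fun c a b => hfe c (some a) b,
      fun c a => hfR c (some a), fun c b => ?_⟩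
    rw [← hfC c b, Fintype.sum_option]
    exact Nat.le_add_left _ _
  · rintro (_ | a) b
    · exact Nat.sub_le _ _
    · exact he a b
  · rintro (_ | a)
    · simp only [Option.elim_none]
      rw [Finset.sum_tsub_distrib _ fun b _ => hC b, Finset.sum_comm,
        Finset.sum_congr rfl fun a _ => hR a, ← Finset.mul_sum, ← Finset.mul_sum, Nat.mul_sub]
    · exact hR a
  · intro b
    rw [Fintype.sum_option]
    exact Nat.sub_add_cancel (hC b)

/-! ### Admissible sequences and outlines -/

variable {r s k : ℕ}

/-- For fixed `K`, the strongest cut takes just the rows with `t` larger than their capacity into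
`K`. Truncated subtraction makes this choice of rows, so one inequality for each `K` covers all
cuts. -/
theorem exists_transport_of_monus {A B : Type*} [Fintype A] [Fintype B] [DecidableEq B] (t : ℤ)
    (u : A → B → ℤ) (C : B → ℤ) (ht : 0 ≤ t) (hu : ∀ a b, 0 ≤ u a b) (hC : ∀ b, 0 ≤ C b)
    (hsum : ∑ b, C b = Fintype.card A * t)
    (h : ∀ K : Finset B, ∑ a, monus t (∑ b ∈ K, u a b) ≤ ∑ b ∈ Kᶜ, C b) :
    ∃ x : A → B → ℕ, (∀ a b, (x a b : ℤ) ≤ u a b) ∧ (∀ a, ∑ b, (x a b : ℤ) = t) ∧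
      ∀ b, ∑ a, (x a b : ℤ) = C b := by
  lift t to ℕ using ht
  choose u' hu' using fun a b => Int.eq_ofNat_of_zero_le (hu a b)
  choose C' hC' using fun b => Int.eq_ofNat_of_zero_le (hC b)
  simp only [hC'] at hsum
  obtain rfl : u = fun a b => (u' a b : ℤ) := funext fun a => funext (hu' a)
  obtain rfl : C = fun b => (C' b : ℤ) := funext hC'
  have key := exists_transport u' (fun _ => t) C' ?_ ?_
  · obtain ⟨x, hx, hR, hC⟩ := key
    exact ⟨x, fun a b => Nat.cast_le.2 (hx a b), fun a => mod_cast hR a, fun b => by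
      dsimp only
      exact_mod_cast hC b⟩
  · rw [Finset.sum_const, Finset.card_univ, smul_eq_mul]
    exact mod_cast hsum.symm
  · intro I K K' hK
    have h1 : ∑ a ∈ I, ((t : ℤ) - ∑ b ∈ K, (u' a b : ℤ)) ≤ ∑ b ∈ K', (C' b : ℤ) :=
      calc ∑ a ∈ I, ((t : ℤ) - ∑ b ∈ K, (u' a b : ℤ))
          ≤ ∑ a ∈ I, monus t (∑ b ∈ K, (u' a b : ℤ)) :=
            Finset.sum_le_sum fun a _ => le_max_right _ _
        _ ≤ ∑ a, monus t (∑ b ∈ K, (u' a b : ℤ)) :=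
            Finset.sum_le_sum_of_subset_of_nonneg (Finset.subset_univ _)
              fun a _ _ => le_max_left _ _
        _ ≤ ∑ b ∈ Kᶜ, (C' b : ℤ) := h K
        _ ≤ ∑ b ∈ K', (C' b : ℤ) :=
            Finset.sum_le_sum_of_subset_of_nonneg
              (fun b hb => (hK b).resolve_left (Finset.mem_compl.1 hb))
              fun b _ _ => Int.natCast_nonneg _
    rw [Finset.sum_sub_distrib, sub_le_iff_le_add] at h1
    exact mod_cast h1

/-- Whatever a row cannot place in `K` it must place in `Kᶜ`. -/
theorem sum_monus_le_of_transport {A B : Type*} [Fintype A] [Fintype B] [DecidableEq B] (t : ℤ)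
    (u x : A → B → ℤ) (hx : ∀ a b, 0 ≤ x a b) (hxu : ∀ a b, x a b ≤ u a b)
    (ht : ∀ a, ∑ b, x a b = t) (K : Finset B) :
    ∑ a, monus t (∑ b ∈ K, u a b) ≤ ∑ b ∈ Kᶜ, ∑ a, x a b := by
  rw [Finset.sum_comm]
  refine Finset.sum_le_sum fun a _ => max_le (Finset.sum_nonneg fun b _ => hx a b) ?_
  have h1 := Finset.sum_add_sum_compl K fun b => x a b
  have h2 : ∑ b ∈ K, x a b ≤ ∑ b ∈ K, u a b := Finset.sum_le_sum fun b _ => hxu a b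
  rw [ht] at h1
  linarith

/-- The amalgamated form of an extension of `M`: the symbol `l` occurs `x i l` times in the new
cells of row `i`, `y j l` times in the new cells of column `j`, and `c l` times in the new
corner. -/
structure IsOutline (n : ℕ) (ρ : Fin k → ℕ) (lam : ℕ) (M : SymbolArray r s k)
    (x : Fin r → Fin k → ℕ) (y : Fin s → Fin k → ℕ) (c : Fin k → ℕ) : Prop where
  total : ∀ l, totalCount M l + ∑ i, x i l + ∑ j, y j l + c l = ρ l
  row_le : ∀ i l, rowCount M i l + x i l ≤ lam
  col_le : ∀ j l, colCount M j l + y j l ≤ lam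
  x_le : ∀ i l, x i l ≤ n - s
  y_le : ∀ j l, y j l ≤ n - r
  c_le : ∀ l, c l ≤ (n - s) * (n - r)
  x_sum : ∀ i, ∑ l, x i l = (n - s) * lam
  y_sum : ∀ j, ∑ l, y j l = (n - r) * lam
  c_sum : ∑ l, c l = (n - s) * ((n - r) * lam)
  x_add_c : ∀ l, ∑ i, x i l + c l ≤ (n - s) * lam
  y_add_c : ∀ l, ∑ j, y j l + c l ≤ (n - r) * lam

theorem sum_count_eq_card {k : ℕ} (m : Multiset (Fin k)) : ∑ l, m.count l = m.card :=
  Multiset.sum_count_eq_card fun _ _ => Finset.mem_univ _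

theorem IsLambdaMatrix.sum_totalCount {lam : ℕ} {M : SymbolArray r s k}
    (hM : IsLambdaMatrix lam M) : ∑ l, totalCount M l = r * (s * lam) := by
  unfold totalCount
  rw [Finset.sum_comm]
  have : ∀ i, ∑ l, ∑ j, (M i j).count l = s * lam := fun i => by
    rw [Finset.sum_comm]
    simp [hM i _]
  simp [this]

theorem IsSimpleAdmissibleSeq.exists_isOutline {n lam : ℕ} {ρ : Fin k → ℕ}
    {M : SymbolArray r s k} {a b : Fin k → ℕ} (h : IsSimpleAdmissibleSeq n ρ lam M a b)
    (hr : r ≤ n) (hs : s ≤ n) (hsum : ∑ l, ρ l = lam * n ^ 2) (hM : IsLatinRectangle ρ lam M) :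
    ∃ x y c, IsOutline n ρ lam M x y c := by
  have hr' : (0 : ℤ) ≤ (n : ℤ) - r := by omega
  have hs' : (0 : ℤ) ≤ (n : ℤ) - s := by omega
  have hcr : ((n - r : ℕ) : ℤ) = (n : ℤ) - r := by omega
  have hcs : ((n - s : ℕ) : ℤ) = (n : ℤ) - s := by omega
  have hp : ∀ l, 0 ≤ forced n ρ lam M r l := fun l => le_max_left _ _
  have hq : ∀ l, 0 ≤ forced n ρ lam M s l := fun l => le_max_left _ _
  have hp' : ∀ l, (ρ l : ℤ) - totalCount M l + lam * r - lam * n ≤ forced n ρ lam M r l :=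
    fun l => le_max_right _ _
  have hq' : ∀ l, (ρ l : ℤ) - totalCount M l + lam * s - lam * n ≤ forced n ρ lam M s l :=
    fun l => le_max_right _ _
  obtain ⟨x, hxu, hxR, hxC⟩ := exists_transport_of_monus (lam * ((n : ℤ) - s)) (rowRoom n lam M)
    (fun l => (a l : ℤ) + forced n ρ lam M r l) (by positivity)
    (fun i l => le_min hs' (by have := hM.row_le i l; omega))
    (fun l => add_nonneg (Int.natCast_nonneg _) (hp l))
    (by rw [Finset.sum_add_distrib, h.sum_a, Fintype.card_fin]; ring) h.row_set
  obtain ⟨y, hyu, hyR, hyC⟩ := exists_transport_of_monus (lam * ((n : ℤ) - r)) (colRoom n lam M)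
    (fun l => (b l : ℤ) + forced n ρ lam M s l) (by positivity)
    (fun i l => le_min hr' (by have := hM.col_le i l; omega))
    (fun l => add_nonneg (Int.natCast_nonneg _) (hq l))
    (by rw [Finset.sum_add_distrib, h.sum_b, Fintype.card_fin]; ring) h.col_set
  -- The corner receives all remaining copies of `l`. The two bounds on `a l + b l` give `0 ≤ c l ≤
  -- (n - s) * (n - r)`.
  have hc0 : ∀ l, 0 ≤ (ρ l : ℤ) - totalCount M l - ∑ i, (x i l : ℤ) - ∑ j, (y j l : ℤ) :=
    fun l => by rw [hxC, hyC]; linarith [h.add_le l]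
  choose c hc using fun l => Int.eq_ofNat_of_zero_le (hc0 l)
  refine ⟨x, y, c, ?_, fun i l => ?_, fun j l => ?_, fun i l => ?_, fun j l => ?_, fun l => ?_,
    fun i => ?_, fun j => ?_, ?_, fun l => ?_, fun l => ?_⟩
  · intro l
    zify
    linarith [hc l]
  · have := (hxu i l).trans (min_le_right _ _)
    omega
  · have := (hyu j l).trans (min_le_right _ _)
    omega
  · have := (hxu i l).trans (min_le_left _ _)
    omega
  · have := (hyu j l).trans (min_le_left _ _)
    omega
  · zify
    rw [hcr, hcs, ← hc, hxC, hyC]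
    linarith [h.le_add l]
  · zify
    rw [hcs, hxR, mul_comm]
  · zify
    rw [hcr, hyR, mul_comm]
  · zify
    rw [hcr, hcs, ← Finset.sum_congr rfl fun l _ => hc l]
    simp only [Finset.sum_sub_distrib, hxC, hyC, Finset.sum_add_distrib, h.sum_a, h.sum_b]
    have h1 : ∑ l, (ρ l : ℤ) = lam * n ^ 2 := mod_cast hsum
    have h2 : ∑ l, (totalCount M l : ℤ) = r * (s * lam) :=
      mod_cast hM.isLambdaMatrix.sum_totalCount
    rw [h1, h2]
    ring
  · zify
    rw [hcs, ← hc, hyC]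
    linarith [hq' l]
  · zify
    rw [hcr, ← hc, hxC, hyC]
    linarith [hp' l]

theorem IsOutline.exists_isSimpleAdmissibleSeq {n lam : ℕ} {ρ : Fin k → ℕ}
    {M : SymbolArray r s k} {x : Fin r → Fin k → ℕ} {y : Fin s → Fin k → ℕ} {c : Fin k → ℕ}
    (h : IsOutline n ρ lam M x y c) (hr : r ≤ n) (hs : s ≤ n) :
    ∃ a b, IsSimpleAdmissibleSeq n ρ lam M a b := by
  have hcr : ((n - r : ℕ) : ℤ) = (n : ℤ) - r := by omega
  have hcs : ((n - s : ℕ) : ℤ) = (n : ℤ) - s := by omega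
  have htot : ∀ l, (totalCount M l : ℤ) + ∑ i, (x i l : ℤ) + ∑ j, (y j l : ℤ) + c l = ρ l :=
    fun l => mod_cast h.total l
  have hxs : ∀ i, ∑ l, (x i l : ℤ) = lam * ((n : ℤ) - s) := fun i => by
    rw [mul_comm, ← hcs]; exact mod_cast h.x_sum i
  have hys : ∀ j, ∑ l, (y j l : ℤ) = lam * ((n : ℤ) - r) := fun j => by
    rw [mul_comm, ← hcr]; exact mod_cast h.y_sum j
  have hxc : ∀ l, ∑ i, (x i l : ℤ) + c l ≤ ((n : ℤ) - s) * lam := fun l => by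
    rw [← hcs]; exact mod_cast h.x_add_c l
  have hyc : ∀ l, ∑ j, (y j l : ℤ) + c l ≤ ((n : ℤ) - r) * lam := fun l => by
    rw [← hcr]; exact mod_cast h.y_add_c l
  have hcle : ∀ l, (c l : ℤ) ≤ ((n : ℤ) - s) * ((n : ℤ) - r) := fun l => by
    rw [← hcr, ← hcs]; exact mod_cast h.c_le l
  have hxu : ∀ i l, (x i l : ℤ) ≤ rowRoom n lam M i l := fun i l =>
    le_min (by have := h.x_le i l; omega) (by have := h.row_le i l; omega)
  have hyu : ∀ j l, (y j l : ℤ) ≤ colRoom n lam M j l := fun j l =>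
    le_min (by have := h.y_le j l; omega) (by have := h.col_le j l; omega)
  -- The copies of `l` outside `M` that do not fit into the new rows lie to the right of `M`; this
  -- makes `a` non-negative, and `hq` does the same for `b`.
  have hp : ∀ l, forced n ρ lam M r l ≤ ∑ i, (x i l : ℤ) := fun l =>
    max_le (by positivity) (by linarith [htot l, hyc l])
  have hq : ∀ l, forced n ρ lam M s l ≤ ∑ j, (y j l : ℤ) := fun l =>
    max_le (by positivity) (by linarith [htot l, hxc l])
  choose a ha using fun l => Int.eq_ofNat_of_zero_le (sub_nonneg.2 (hp l))
  choose b hb using fun l => Int.eq_ofNat_of_zero_le (sub_nonneg.2 (hq l))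
  have ha' : ∀ l, (a l : ℤ) + forced n ρ lam M r l = ∑ i, (x i l : ℤ) := fun l => by
    rw [← ha]; ring
  have hb' : ∀ l, (b l : ℤ) + forced n ρ lam M s l = ∑ j, (y j l : ℤ) := fun l => by
    rw [← hb]; ring
  refine ⟨a, b, ?_, ?_, fun l => ?_, fun l => ?_, fun l => ?_, fun l => ?_, fun i => ?_,
    fun j => ?_, fun K => ?_, fun K => ?_⟩
  · rw [← Finset.sum_congr rfl fun l _ => ha l, Finset.sum_sub_distrib, Finset.sum_comm]
    simp only [hxs, Finset.sum_const, Finset.card_univ, Fintype.card_fin, nsmul_eq_mul]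
    ring
  · rw [← Finset.sum_congr rfl fun l _ => hb l, Finset.sum_sub_distrib, Finset.sum_comm]
    simp only [hys, Finset.sum_const, Finset.card_univ, Fintype.card_fin, nsmul_eq_mul]
    ring
  · rw [← ha]
    exact sub_le_sub_right (Finset.sum_le_sum fun i _ => hxu i l) _
  · rw [← hb]
    exact sub_le_sub_right (Finset.sum_le_sum fun j _ => hyu j l) _
  · linarith [ha l, hb l, htot l, Int.natCast_nonneg (c l)]
  · linarith [ha l, hb l, htot l, hcle l]
  · rw [← hxs i]
    exact Finset.sum_le_sum fun l _ => hxu i l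
  · rw [← hys j]
    exact Finset.sum_le_sum fun l _ => hyu j l
  · rw [Finset.sum_congr rfl fun l _ => ha' l]
    exact sum_monus_le_of_transport _ _ (fun i l => (x i l : ℤ)) (fun _ _ => Int.natCast_nonneg _)
      hxu hxs K
  · rw [Finset.sum_congr rfl fun l _ => hb' l]
    exact sum_monus_le_of_transport _ _ (fun j l => (y j l : ℤ)) (fun _ _ => Int.natCast_nonneg _)
      hyu hys K

/-! ### From outlines to squares -/

/-- Splitting the amalgamated new columns and then the amalgamated new rows. -/
theorem exists_filling {A B S : Type*} [Fintype A] [Fintype B] [Fintype S] (p q lam : ℕ)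
    (x : A → S → ℕ) (y : B → S → ℕ) (c : S → ℕ)
    (x_le : ∀ i l, x i l ≤ q) (y_le : ∀ j l, y j l ≤ p) (c_le : ∀ l, c l ≤ q * p)
    (x_sum : ∀ i, ∑ l, x i l = q * lam) (y_sum : ∀ j, ∑ l, y j l = p * lam)
    (c_sum : ∑ l, c l = q * (p * lam))
    (x_add_c : ∀ l, ∑ i, x i l + c l ≤ q * lam) (y_add_c : ∀ l, ∑ j, y j l + c l ≤ p * lam) :
    ∃ (X : A → Fin q → S → ℕ) (Y : Fin p → B → S → ℕ) (Z : Fin p → Fin q → S → ℕ),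
      ((∀ i j l, X i j l ≤ 1) ∧ (∀ i j l, Y i j l ≤ 1) ∧ ∀ i j l, Z i j l ≤ 1) ∧
      ((∀ i j, ∑ l, X i j l = lam) ∧ (∀ i j, ∑ l, Y i j l = lam) ∧ ∀ i j, ∑ l, Z i j l = lam) ∧
      ((∀ i l, ∑ j, X i j l = x i l) ∧ (∀ j l, ∑ i, Y i j l = y j l) ∧
        ∀ l, ∑ i, ∑ j, Z i j l = c l) ∧
      (∀ i l, ∑ j, Y i j l + ∑ j, Z i j l ≤ lam) ∧
      ∀ j l, ∑ i, X i j l + ∑ i, Z i j l ≤ lam := by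
  -- The row `none` is the merged new row. Each of its cells still stands for `p` cells, hence the
  -- capacity `p` and the sum `p * lam`.
  obtain ⟨f, hf, hfe, hfR, hfC⟩ := exists_decomposition_le (A := Option A) q
    (fun o l => o.elim (c l) fun i => x i l) (fun o _ => o.elim p fun _ => 1)
    (fun o => o.elim (p * lam) fun _ => lam) (fun _ => lam)
    (by rintro (_ | i) l; exacts [c_le l, by simpa using x_le i l])
    (by rintro (_ | i); exacts [c_sum, x_sum i])
    (fun l => by rw [Fintype.sum_option, add_comm]; exact x_add_c l)
  -- Only the merged row is split here, into `p` rows; its cells lie in the old columns `B` and in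
  -- the `q` columns just obtained. Their symbol counts are kept, so the bounds on the new columns
  -- survive.
  obtain ⟨g, hg, hge, hgR, hgC⟩ := exists_decomposition_le (A := B ⊕ Fin q) p
    (fun o l => o.elim (fun j => y j l) fun j => f j none l) (fun _ _ => 1)
    (fun _ => lam) (fun _ => lam)
    (by rintro (j | j) l; exacts [by simpa using y_le j l, by simpa using hfe j none l])
    (by rintro (j | j); exacts [y_sum j, hfR j none])
    (fun l => by
      rw [Fintype.sum_sum_type]
      simp only [Sum.elim_inl, Sum.elim_inr]
      rw [hf none l]
      exact y_add_c l)
  refine ⟨fun i j l => f j (some i) l, fun i j l => g i (.inl j) l, fun i j l => g i (.inr j) l,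
    ⟨fun i j l => hfe j (some i) l, fun i j l => hge i _ l, fun i j l => hge i _ l⟩,
    ⟨fun i j => hfR j (some i), fun i j => hgR i _, fun i j => hgR i _⟩,
    ⟨fun i l => hf (some i) l, fun j l => hg (.inl j) l, fun l => ?_⟩, fun i l => ?_,
    fun j l => ?_⟩
  · rw [Finset.sum_comm, Finset.sum_congr rfl fun j _ => hg (.inr j) l]
    exact hf none l
  · have := hgC i l
    rwa [Fintype.sum_sum_type] at this
  · rw [hg (.inr j) l]
    have := hfC j l
    rw [Fintype.sum_option, add_comm] at this
    exact this

/-- The index `Fin n`, split into the first `t` indices and the others. -/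
def splitEquiv {n t : ℕ} (h : t ≤ n) : Fin t ⊕ Fin (n - t) ≃ Fin n :=
  finSumFinEquiv.trans (finCongr (Nat.add_sub_cancel' h))

theorem splitEquiv_inl {n t : ℕ} (h : t ≤ n) (i : Fin t) :
    splitEquiv h (.inl i) = Fin.castLE h i := by
  ext
  simp [splitEquiv]

theorem sum_splitEquiv {n t : ℕ} (h : t ≤ n) (f : Fin n → ℕ) :
    ∑ i, f i = ∑ i, f (Fin.castLE h i) + ∑ i, f (splitEquiv h (.inr i)) := by
  rw [← (splitEquiv h).sum_comp, Fintype.sum_sum_type]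
  simp only [splitEquiv_inl]

/-- The multiset in which the symbol `l` occurs `f l` times. -/
def multisetOfCount (f : Fin k → ℕ) : Multiset (Fin k) := ∑ l, Multiset.replicate (f l) l

theorem count_multisetOfCount (f : Fin k → ℕ) (l : Fin k) : (multisetOfCount f).count l = f l := by
  simp [multisetOfCount, Multiset.count_sum', Multiset.count_replicate]

theorem card_multisetOfCount (f : Fin k → ℕ) : (multisetOfCount f).card = ∑ l, f l := by
  simp [multisetOfCount]

theorem IsOutline.exists_extension {n lam : ℕ} {ρ : Fin k → ℕ}
    {M : SymbolArray r s k} {x : Fin r → Fin k → ℕ} {y : Fin s → Fin k → ℕ} {c : Fin k → ℕ}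
    (h : IsOutline n ρ lam M x y c) (hr : r ≤ n) (hs : s ≤ n) (hM : IsLambdaMatrix lam M)
    (hMs : IsSimple M) :
    ∃ N : SymbolArray n n k, IsLatinSquare ρ lam N ∧ IsSimple N ∧ IsExtensionOf hr hs N M := by
  obtain ⟨X, Y, Z, ⟨hX, hY, hZ⟩, ⟨sX, sY, sZ⟩, ⟨tX, tY, tZ⟩, hYZ, hXZ⟩ :=
    exists_filling (n - r) (n - s) lam x y c h.x_le h.y_le h.c_le h.x_sum h.y_sum h.c_sum
      h.x_add_c h.y_add_c
  let G : Fin r ⊕ Fin (n - r) → Fin s ⊕ Fin (n - s) → Multiset (Fin k) := fun i j =>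
    i.elim (fun i => j.elim (fun j => M i j) fun j => multisetOfCount (X i j))
      fun i => j.elim (fun j => multisetOfCount (Y i j)) fun j => multisetOfCount (Z i j)
  let N : SymbolArray n n k := fun i j => G ((splitEquiv hr).symm i) ((splitEquiv hs).symm j)
  have hN : ∀ i j, N (splitEquiv hr i) (splitEquiv hs j) = G i j := fun i j => by simp [N]
  have hrow : ∀ i l, rowCount N (splitEquiv hr i) l = ∑ j, (G i j).count l := fun i l => by
    rw [rowCount, ← (splitEquiv hs).sum_comp]
    simp only [hN]
  have hcol : ∀ j l, colCount N (splitEquiv hs j) l = ∑ i, (G i j).count l := fun j l => by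
    rw [colCount, ← (splitEquiv hr).sum_comp]
    simp only [hN]
  have htot : ∀ l, totalCount N l = ∑ i, ∑ j, (G i j).count l := fun l => by
    rw [totalCount, ← (splitEquiv hr).sum_comp]
    exact Finset.sum_congr rfl fun i _ => hrow i l
  refine ⟨N, ⟨fun i j => ?_, fun l => ?_, fun i l => ?_, fun j l => ?_⟩, fun i j l => ?_,
    fun i j => ?_⟩
  · obtain ⟨i, rfl⟩ := (splitEquiv hr).surjective i
    obtain ⟨j, rfl⟩ := (splitEquiv hs).surjective j
    rw [hN]
    rcases i with i | i <;> rcases j with j | j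
    · exact hM i j
    · exact (card_multisetOfCount _).trans (sX i j)
    · exact (card_multisetOfCount _).trans (sY i j)
    · exact (card_multisetOfCount _).trans (sZ i j)
  · rw [htot, ← h.total l]
    simp only [G, Fintype.sum_sum_type, Sum.elim_inl, Sum.elim_inr, count_multisetOfCount,
      Finset.sum_add_distrib, tX, tZ, totalCount]
    have hY : ∑ i, ∑ j, Y i j l = ∑ j, y j l :=
      Finset.sum_comm.trans (Finset.sum_congr rfl fun j _ => tY j l)
    rw [hY]
    ring
  · obtain ⟨i, rfl⟩ := (splitEquiv hr).surjective i
    rw [hrow]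
    rcases i with i | i
    · simp only [G, Fintype.sum_sum_type, Sum.elim_inl, Sum.elim_inr, count_multisetOfCount, tX]
      exact h.row_le i l
    · simp only [G, Fintype.sum_sum_type, Sum.elim_inl, Sum.elim_inr, count_multisetOfCount]
      exact hYZ i l
  · obtain ⟨j, rfl⟩ := (splitEquiv hs).surjective j
    rw [hcol]
    rcases j with j | j
    · simp only [G, Fintype.sum_sum_type, Sum.elim_inl, Sum.elim_inr, count_multisetOfCount, tY]
      exact h.col_le j l
    · simp only [G, Fintype.sum_sum_type, Sum.elim_inl, Sum.elim_inr, count_multisetOfCount]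
      exact hXZ j l
  · obtain ⟨i, rfl⟩ := (splitEquiv hr).surjective i
    obtain ⟨j, rfl⟩ := (splitEquiv hs).surjective j
    rw [hN]
    rcases i with i | i <;> rcases j with j | j
    · exact hMs i j l
    · exact (count_multisetOfCount _ _).trans_le (hX i j l)
    · exact (count_multisetOfCount _ _).trans_le (hY i j l)
    · exact (count_multisetOfCount _ _).trans_le (hZ i j l)
  · rw [← splitEquiv_inl, ← splitEquiv_inl, hN]
    rfl

/-! ### From squares to outlines, and the main theorem -/

theorem IsLatinSquare.exists_isOutline {n lam : ℕ} {ρ : Fin k → ℕ} {M : SymbolArray r s k}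
    {N : SymbolArray n n k} (hN : IsLatinSquare ρ lam N) (hNs : IsSimple N) {hr : r ≤ n}
    {hs : s ≤ n} (hNM : IsExtensionOf hr hs N M) : ∃ x y c, IsOutline n ρ lam M x y c := by
  let v : Fin (n - r) → Fin n := fun i => splitEquiv hr (.inr i)
  let w : Fin (n - s) → Fin n := fun j => splitEquiv hs (.inr j)
  have hrow : ∀ i l, rowCount N i l =
      ∑ j, (N i (Fin.castLE hs j)).count l + ∑ j, (N i (w j)).count l :=
    fun i l => sum_splitEquiv hs _
  have hcol : ∀ j l, colCount N j l =
      ∑ i, (N (Fin.castLE hr i) j).count l + ∑ i, (N (v i) j).count l :=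
    fun j l => sum_splitEquiv hr _
  have hrowM : ∀ i l, rowCount M i l = ∑ j, (N (Fin.castLE hr i) (Fin.castLE hs j)).count l :=
    fun i l => Finset.sum_congr rfl fun j _ => by rw [hNM]
  have hcolM : ∀ j l, colCount M j l = ∑ i, (N (Fin.castLE hr i) (Fin.castLE hs j)).count l :=
    fun j l => Finset.sum_congr rfl fun i _ => by rw [hNM]
  have hcell : ∀ i j, ∑ l, (N i j).count l = lam := fun i j =>
    (sum_count_eq_card _).trans (hN.isLambdaMatrix i j)
  refine ⟨fun i l => ∑ j, (N (Fin.castLE hr i) (w j)).count l,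
    fun j l => ∑ i, (N (v i) (Fin.castLE hs j)).count l,
    fun l => ∑ i, ∑ j, (N (v i) (w j)).count l, fun l => ?_, fun i l => ?_, fun j l => ?_,
    fun i l => ?_, fun j l => ?_, fun l => ?_, fun i => ?_, fun j => ?_, ?_, fun l => ?_,
    fun l => ?_⟩
  · have h1 : totalCount N l = ∑ i, rowCount N i l := rfl
    have h2 : totalCount M l = ∑ i, rowCount M i l := rfl
    rw [← hN.total_eq, h1, h2, sum_splitEquiv hr]
    simp only [hrow, hrowM, Finset.sum_add_distrib]
    have h3 : ∑ j, ∑ i, (N (v i) (Fin.castLE hs j)).count l =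
        ∑ i, ∑ j, (N (v i) (Fin.castLE hs j)).count l := Finset.sum_comm
    rw [h3]
    simp only [v]
    ring
  · rw [hrowM, ← hrow]
    exact hN.row_le _ l
  · rw [hcolM, ← hcol]
    exact hN.col_le _ l
  · simpa using Finset.sum_le_sum fun j (_ : j ∈ Finset.univ) => hNs (Fin.castLE hr i) (w j) l
  · simpa using Finset.sum_le_sum fun i (_ : i ∈ Finset.univ) => hNs (v i) (Fin.castLE hs j) l
  · simpa [mul_comm] using Finset.sum_le_sum fun i (_ : i ∈ Finset.univ) =>
      Finset.sum_le_sum fun j (_ : j ∈ Finset.univ) => hNs (v i) (w j) l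
  · rw [Finset.sum_comm]
    simp [hcell]
  · rw [Finset.sum_comm]
    simp [hcell]
  · rw [Finset.sum_comm]
    have : ∀ i, ∑ l, ∑ j, (N (v i) (w j)).count l = (n - s) * lam := fun i => by
      rw [Finset.sum_comm]
      simp [hcell]
    simp only [this, Finset.sum_const, Finset.card_univ, Fintype.card_fin, smul_eq_mul]
    ring
  · have h1 : ∑ i, ∑ j, (N (Fin.castLE hr i) (w j)).count l =
        ∑ j, ∑ i, (N (Fin.castLE hr i) (w j)).count l := Finset.sum_comm
    have h2 : ∑ i, ∑ j, (N (v i) (w j)).count l =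
        ∑ j, ∑ i, (N (v i) (w j)).count l := Finset.sum_comm
    rw [h1, h2, ← Finset.sum_add_distrib]
    have : ∀ j, ∑ i, (N (Fin.castLE hr i) (w j)).count l + ∑ i, (N (v i) (w j)).count l ≤ lam :=
      fun j => (hcol (w j) l).symm.trans_le (hN.col_le _ l)
    simpa using Finset.sum_le_sum fun j (_ : j ∈ Finset.univ) => this j
  · rw [Finset.sum_comm, ← Finset.sum_add_distrib]
    have : ∀ i, ∑ j, (N (v i) (Fin.castLE hs j)).count l + ∑ j, (N (v i) (w j)).count l ≤ lam :=
      fun i => (hrow (v i) l).symm.trans_le (hN.row_le _ l)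
    simpa using Finset.sum_le_sum fun i (_ : i ∈ Finset.univ) => this i

theorem IsSimple.lam_le {lam : ℕ} {M : SymbolArray r s k} (hMs : IsSimple M)
    (hM : IsLambdaMatrix lam M) (i : Fin r) (j : Fin s) : lam ≤ k := by
  rw [← hM i j, ← sum_count_eq_card]
  simpa using Finset.sum_le_sum fun l (_ : l ∈ Finset.univ) => hMs i j l

end MultiLatin

theorem mainTheorem1 (r s n k lam : ℕ) (hn : 1 ≤ n) (hk : 1 ≤ k) (hlam : 1 ≤ lam)
    (hr : r ≤ n) (hs : s ≤ n) (hnk : n ≤ k)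
    (ρ : Fin k → ℕ) (hρ : ∀ l, 1 ≤ ρ l ∧ ρ l ≤ lam * n) (hsum : ∑ l, ρ l = lam * n ^ 2)
    (M : MultiLatin.SymbolArray r s k)
    (hM : MultiLatin.IsLatinRectangle ρ lam M) (hMs : MultiLatin.IsSimple M) :
    (∃ N : MultiLatin.SymbolArray n n k, MultiLatin.IsLatinSquare ρ lam N ∧
        MultiLatin.IsSimple N ∧ MultiLatin.IsExtensionOf hr hs N M) ↔
      MultiLatin.IsSimplyAdmissible n ρ lam M := by
  constructor
  · rintro ⟨N, hN, hNs, hNM⟩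
    obtain ⟨x, y, c, h⟩ := hN.exists_isOutline hNs hNM
    -- The cell is taken from `N`, which has one because `1 ≤ n`; `M` may be empty.
    exact ⟨hNs.lam_le hN.isLambdaMatrix ⟨0, hn⟩ ⟨0, hn⟩, h.exists_isSimpleAdmissibleSeq hr hs⟩
  · rintro ⟨-, a, b, h⟩
    obtain ⟨x, y, c, h⟩ := h.exists_isOutline hr hs hsum hM
    exact h.exists_extension hr hs hM.isLambdaMatrix hMs
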